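/- Let $\mathbf{sSet}$ be the category of simplicial sets and $\mathbf{sCat}$ the category of small simplicially enriched categories and simplicial functors. Each carries a covariant involution $(-)^{\mathrm{op}}$: for a simplicial set it reverses the order of the vertices of simplices, and for a simplicial category $X$ the opposite $X^{\mathrm{op}}$ has the same objects and $X^{\mathrm{op}}(a,b)=X(b,a)$; the double opposite is identified with the identity. In either category an anti-involution on an object $Y$ is a map $\tau\colon Y^{\mathrm{op}}\to Y$ with $\tau^{\mathrm{op}}\circ\tau=\mathrm{id}_{Y^{\mathrm{op}}}$. Let $\mathbf{isSet}$ and $\mathbf{isCat}$ be the categories of pairs $(Y,\tau)$ consisting of a simplicial set (respectively a small simplicial category) and an anti-involution on it; a morphism $(Y,\tau)\to(Y',\tau')$ is a map $f\colon Y\to Y'$ with $\tau' f^{\mathrm{op}}=f\tau$. Let $\mathfrak{C}\colon\mathbf{sSet}\rightleftarrows\mathbf{sCat}\colon N_{hc}$ be the adjunction between the realization $\mathfrak{C}$ (the colimit-preserving extension of the simplicial thickening $[n]\mapsto\mathfrak{C}[\Delta^n]$) and the homotopy coherent nerve $N_{hc}(X)_n=\mathbf{sCat}(\mathfrak{C}[\Delta^n],X)$,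 with unit $\eta$ and counit $\varepsilon$. (1) There exist natural isomorphisms $z\colon N_{hc}(-)^{\mathrm{op}}\to N_{hc}((-)^{\mathrm{op}})$ and $w\colon\mathfrak{C}(-)^{\mathrm{op}}\to\mathfrak{C}((-)^{\mathrm{op}})$ which are coherent, meaning that $z^{-1}=z^{\mathrm{op}}$ (that is, $(z_X)^{\mathrm{op}}$ and $z_{X^{\mathrm{op}}}$ are mutually inverse for every $X$), $w^{-1}=w^{\mathrm{op}}$ (likewise), and, for every simplicial set $A$, \[ w_A^{-1}=\varepsilon_{(\mathfrak{C}A)^{\mathrm{op}}}\circ\mathfrak{C}(z_{\mathfrak{C}A})\circ\mathfrak{C}((\eta_A)^{\mathrm{op}}). \] (2) Let $z,w$ be any coherent pair as in (1). If $\tau\colon X^{\mathrm{op}}\to X$ is an anti-involution in $\mathbf{sCat}$, then $N_{hc}(\tau)\circ z_X$ is an anti-involution on $N_{hc}(X)$; if $\sigma\colon A^{\mathrm{op}}\to A$ is an anti-involution in $\mathbf{sSet}$, then $\mathfrak{C}(\sigma)\circ w_A$ is an anti-involution on $\mathfrak{C}(A)$. Hence \[ \widetilde{\mathfrak{C}}(A,\sigma)=(\mathfrak{C}(A),\,\mathfrak{C}(\sigma)\circ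 w_A),\qquad \widetilde{N}_{hc}(X,\tau)=(N_{hc}(X),\,N_{hc}(\tau)\circ z_X), \] acting on morphisms as $\mathfrak{C}$ and $N_{hc}$, are functors $\widetilde{\mathfrak{C}}\colon\mathbf{isSet}\to\mathbf{isCat}$ and $\widetilde{N}_{hc}\colon\mathbf{isCat}\to\mathbf{isSet}$. The functor $\widetilde{\mathfrak{C}}$ is left adjoint to $\widetilde{N}_{hc}$, by an adjunction that lifts $\mathfrak{C}\dashv N_{hc}$: the map underlying the adjunct of $f$ is the adjunct of the map underlying $f$. -/

import Mathlib

open CategoryTheory MonoidalCategory Opposite Limits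

universe u

/-- A small simplicially enriched category (objects form a small type, homs are simplicial sets). -/
structure SCat : Type (u + 1) where
  /-- the type of objects -/
  carrier : Type u
  [enriched : EnrichedCategory SSet.{u} carrier]

namespace SCat

instance : CoeSort SCat.{u} (Type u) := ⟨carrier⟩

attribute [instance] SCat.enriched

theorem functor_ext {C D : Type u} [EnrichedCategory SSet.{u} C] [EnrichedCategory SSet.{u} D]
    {F G : EnrichedFunctor SSet.{u} C D} (hobj : ∀ x, F.obj x = G.obj x)
    (hmap : ∀ (x y : C) (m : SimplexCategoryᵒᵖ) (s : (x ⟶[SSet.{u}] y).obj m),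
      (F.map x y).app m s ≍ (G.map x y).app m s) : F = G := by
  obtain ⟨Fo, Fm, _, _⟩ := F
  obtain ⟨Go, Gm, _, _⟩ := G
  obtain rfl : Fo = Go := funext hobj
  obtain rfl : Fm = Gm := by
    funext x y
    ext m s
    exact eq_of_heq (hmap x y m s)
  rfl

/-- The category of small simplicial categories; morphisms are simplicial functors. -/
instance : Category.{u} SCat.{u} where
  Hom X Y := EnrichedFunctor SSet.{u} X Y
  id X := EnrichedFunctor.id SSet.{u} X
  comp F G := EnrichedFunctor.comp SSet.{u} F G
  id_comp _ := functor_ext (fun _ => rfl) (fun _ _ _ _ => HEq.rfl)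
  comp_id _ := functor_ext (fun _ => rfl) (fun _ _ _ _ => HEq.rfl)
  assoc _ _ _ := functor_ext (fun _ => rfl) (fun _ _ _ _ => HEq.rfl)

/-- The opposite simplicial functor, acting on objects and homs as `F`. -/
def opMap {X Y : SCat.{u}} (F : EnrichedFunctor SSet.{u} X Y) :
    EnrichedFunctor SSet.{u} Xᵒᵖ Yᵒᵖ where
  obj x := op (F.obj x.unop)
  map x y := F.map y.unop x.unop
  map_id x := F.map_id x.unop
  map_comp x y z := by
    have h := F.map_comp z.unop y.unop x.unop
    rw [eComp_op_eq, eComp_op_eq, Category.assoc, h]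
    exact (BraidedCategory.braiding_naturality_assoc _ _ _).symm

/-- The opposite `Xᵒᵖ` of a simplicial category: same objects, `Xᵒᵖ(a, b) = X(b, a)`. -/
def opFunctor : SCat.{u} ⥤ SCat.{u} where
  obj X := ⟨(X : Type u)ᵒᵖ⟩
  map F := opMap F
  map_id _ := rfl
  map_comp _ _ := rfl

/-- The evident identification of the double opposite of `X` with `X`. -/
def opOpIsoApp (X : SCat.{u}) : opFunctor.obj (opFunctor.obj X) ≅ X where
  hom :=
    { obj := fun x => x.unop.unop
      map := fun _ _ => 𝟙 _
      map_id := fun _ => rfl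
      map_comp := fun x y z => by
        ext m s
        rfl }
  inv :=
    { obj := fun x => op (op x)
      map := fun _ _ => 𝟙 _
      map_id := fun _ => rfl
      map_comp := fun x y z => by
        ext m s
        rfl }
  hom_inv_id := rfl
  inv_hom_id := rfl

/-- The opposite functor of `SCat` is an involution. -/
def opOpIso : opFunctor.{u} ⋙ opFunctor.{u} ≅ 𝟭 SCat.{u} :=
  NatIso.ofComponents opOpIsoApp (fun _ => rfl)

/-- The simplicial thickening of the linear orders `{0 < ... < n}`, as a cosimplicial object in
simplicial categories. -/
def thickening : SimplexCategory ⥤ SCat.{u} where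
  obj n := ⟨SimplicialThickening (ULift.{u} (Fin (n.len + 1)))⟩
  map f := SimplicialThickening.functor f.toOrderHom.uliftMap
  map_id _ := SimplicialThickening.functor_id _
  map_comp f g := SimplicialThickening.functor_comp f.toOrderHom.uliftMap g.toOrderHom.uliftMap

/-- The homotopy coherent nerve: the `n`-simplices of `Nhc.obj X` are the simplicial functors
from the simplicial thickening of `{0 < ... < n}` to `X`. -/
def Nhc : SCat.{u} ⥤ SSet.{u} := Presheaf.restrictedULiftYoneda.{0} thickening.{u}

/-! ### Composition of simplices of the hom objects -/

section Elementwise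

variable {C : Type u} [EnrichedCategory SSet.{u} C] {m m' : SimplexCategoryᵒᵖ}

/-- A pair of simplices, as a simplex of the product. -/
def pair {K L : SSet.{u}} (s : K.obj m) (t : L.obj m) : (K ⊗ L).obj m := (s, t)

/-- The `m`-simplices of the hom object from `x` to `y`. -/
abbrev Simp (m : SimplexCategoryᵒᵖ) (x y : C) : Type u := (x ⟶[SSet.{u}] y).obj m

/-- The identity of `x`, as a degenerate `m`-simplex. -/
def sId (m : SimplexCategoryᵒᵖ) (x : C) : Simp m x x := (eId SSet.{u} x).app m PUnit.unit

/-- Composition of `m`-simplices. -/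
def sComp {x y z : C} (s : Simp m x y) (t : Simp m y z) : Simp m x z :=
  (eComp SSet.{u} x y z).app m (pair s t)

theorem sId_sComp {x y : C} (s : Simp m x y) : sComp (sId m x) s = s :=
  ConcreteCategory.congr_hom (NatTrans.congr_app (e_id_comp SSet.{u} x y) m) s

theorem sComp_sId {x y : C} (s : Simp m x y) : sComp s (sId m y) = s :=
  ConcreteCategory.congr_hom (NatTrans.congr_app (e_comp_id SSet.{u} x y) m) s

theorem sComp_assoc {w x y z : C} (r : Simp m w x) (s : Simp m x y) (t : Simp m y z) :
    sComp (sComp r s) t = sComp r (sComp s t) := by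
  let p := pair r (pair s t)
  exact ConcreteCategory.congr_hom (NatTrans.congr_app (e_assoc SSet.{u} w x y z) m) p

theorem map_sId (f : m ⟶ m') (x : C) : (x ⟶[SSet.{u}] x).map f (sId m x) = sId m' x :=
  (NatTrans.naturality_apply (eId SSet.{u} x) f PUnit.unit).symm

theorem map_sComp (f : m ⟶ m') {x y z : C} (s : Simp m x y) (t : Simp m y z) :
    (x ⟶[SSet.{u}] z).map f (sComp s t) =
      sComp ((x ⟶[SSet.{u}] y).map f s) ((y ⟶[SSet.{u}] z).map f t) := by
  let p := pair s t
  exact (NatTrans.naturality_apply (eComp SSet.{u} x y z) f p).symm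

theorem functor_sId {D : Type u} [EnrichedCategory SSet.{u} D] (F : EnrichedFunctor SSet.{u} C D)
    (x : C) : (F.map x x).app m (sId m x) = sId m (F.obj x) :=
  ConcreteCategory.congr_hom (NatTrans.congr_app (F.map_id x) m) PUnit.unit

theorem functor_sComp {D : Type u} [EnrichedCategory SSet.{u} D]
    (F : EnrichedFunctor SSet.{u} C D) {x y z : C} (s : Simp m x y) (t : Simp m y z) :
    (F.map x z).app m (sComp s t) = sComp ((F.map x y).app m s) ((F.map y z).app m t) := by
  let p := pair s t
  exact ConcreteCategory.congr_hom (NatTrans.congr_app (F.map_comp x y z) m) p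

theorem sComp_heq {x y z x' y' z' : C} (hx : x = x') (hy : y = y') (hz : z = z')
    {s : Simp m x y} {t : Simp m y z} {s' : Simp m x' y'} {t' : Simp m y' z'}
    (hs : s ≍ s') (ht : t ≍ t') : sComp s t ≍ sComp s' t' := by
  subst hx hy hz
  rw [eq_of_heq hs, eq_of_heq ht]

theorem sId_heq {x x' : C} (hx : x = x') : sId m x ≍ sId m x' := by rw [hx]

theorem map_heq (f : m ⟶ m') {x y x' y' : C} (hx : x = x') (hy : y = y')
    {s : Simp m x y} {s' : Simp m x' y'} (hs : s ≍ s') :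
    (x ⟶[SSet.{u}] y).map f s ≍ (x' ⟶[SSet.{u}] y').map f s' := by
  subst hx hy
  rw [eq_of_heq hs]

theorem functor_congr {X Y : SCat.{u}} {F G : X ⟶ Y} (h : F = G) (x y : X) (s : Simp m x y) :
    (EnrichedFunctor.map F x y).app m s ≍ (EnrichedFunctor.map G x y).app m s := by rw [h]

end Elementwise

/-! ### Colimits of simplicial categories, by generators and relations -/

namespace Colim

variable {J : Type u} [Category.{0} J] (D : J ⥤ SCat.{u})

/-- Two objects of the diagram are identified along the transition functors. -/
inductive ObRel : (Σ j, D.obj j) → (Σ j, D.obj j) → Prop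
  | map {j j' : J} (f : j ⟶ j') (a : D.obj j) : ObRel ⟨j, a⟩ ⟨j', EnrichedFunctor.obj (D.map f) a⟩

/-- Objects of the colimit. -/
def Ob : Type u := Quot (ObRel D)

variable {D}

/-- The class of an object of the diagram. -/
def ob (j : J) (a : D.obj j) : Ob D := Quot.mk _ ⟨j, a⟩

theorem ob_map {j j' : J} (f : j ⟶ j') (a : D.obj j) :
    ob j' (EnrichedFunctor.obj (D.map f) a) = ob j a := (Quot.sound (ObRel.map f a)).symm

variable (D)

/-- Formal composites of `m`-simplices of the categories of the diagram. -/
inductive Word (m : SimplexCategoryᵒᵖ) : Ob D → Ob D → Type u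
  | of {x y : Ob D} (j : J) (a b : D.obj j) (s : Simp m a b) (hx : ob j a = x) (hy : ob j b = y) :
      Word m x y
  | id (x : Ob D) : Word m x x
  | comp {x y z : Ob D} (p : Word m x y) (q : Word m y z) : Word m x z

variable {D}

/-- The congruence on words generated by the category axioms, the relations of the categories of
the diagram, and the transition functors. -/
inductive WordRel (m : SimplexCategoryᵒᵖ) : {x y : Ob D} → Word D m x y → Word D m x y → Prop
  | refl {x y : Ob D} (p : Word D m x y) : WordRel m p p
  | symm {x y : Ob D} {p q : Word D m x y} : WordRel m p q → WordRel m q p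
  | trans {x y : Ob D} {p q r : Word D m x y} : WordRel m p q → WordRel m q r → WordRel m p r
  | congr {x y z : Ob D} {p p' : Word D m x y} {q q' : Word D m y z} :
      WordRel m p p' → WordRel m q q' → WordRel m (p.comp q) (p'.comp q')
  | id_comp {x y : Ob D} (p : Word D m x y) : WordRel m ((Word.id x).comp p) p
  | comp_id {x y : Ob D} (p : Word D m x y) : WordRel m (p.comp (Word.id y)) p
  | assoc {w x y z : Ob D} (p : Word D m w x) (q : Word D m x y) (r : Word D m y z) :
      WordRel m ((p.comp q).comp r) (p.comp (q.comp r))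
  | of_id {x : Ob D} (j : J) (a : D.obj j) (hx : ob j a = x) :
      WordRel m (Word.of j a a (sId m a) hx hx) (Word.id x)
  | of_comp {x y z : Ob D} (j : J) (a b c : D.obj j) (s : Simp m a b) (t : Simp m b c)
      (hx : ob j a = x) (hy : ob j b = y) (hz : ob j c = z) :
      WordRel m ((Word.of j a b s hx hy).comp (Word.of j b c t hy hz))
        (Word.of j a c (sComp s t) hx hz)
  | of_map {x y : Ob D} {j j' : J} (f : j ⟶ j') (a b : D.obj j) (s : Simp m a b)
      (hx : ob j a = x) (hy : ob j b = y) :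
      WordRel m (Word.of j a b s hx hy)
        (Word.of j' _ _ ((EnrichedFunctor.map (D.map f) a b).app m s)
          ((ob_map f a).trans hx) ((ob_map f b).trans hy))

/-- Simplicial operators act on words letter by letter. -/
def Word.act {m m' : SimplexCategoryᵒᵖ} (f : m ⟶ m') {x y : Ob D} : Word D m x y → Word D m' x y
  | .of j a b s hx hy => .of j a b ((a ⟶[SSet.{u}] b).map f s) hx hy
  | .id x => .id x
  | .comp p q => .comp (p.act f) (q.act f)

theorem WordRel.act {m m' : SimplexCategoryᵒᵖ} (f : m ⟶ m') {x y : Ob D} {p q : Word D m x y}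
    (h : WordRel m p q) : WordRel m' (p.act f) (q.act f) := by
  induction h with
  | refl p => exact .refl _
  | symm _ ih => exact ih.symm
  | trans _ _ ih ih' => exact ih.trans ih'
  | congr _ _ ih ih' => exact .congr ih ih'
  | id_comp p => exact .id_comp _
  | comp_id p => exact .comp_id _
  | assoc p q r => exact .assoc _ _ _
  | of_id j a hx =>
    simp only [Word.act, map_sId]
    exact .of_id _ _ _
  | of_comp j a b c s t hx hy hz =>
    simp only [Word.act, map_sComp]
    exact .of_comp _ _ _ _ _ _ _ _ _
  | of_map g a b s hx hy =>
    simp only [Word.act]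
    rw [← NatTrans.naturality_apply]
    exact .of_map g _ _ _ _ _

theorem Word.act_id {m : SimplexCategoryᵒᵖ} {x y : Ob D} (p : Word D m x y) :
    p.act (𝟙 m) = p := by
  induction p with
  | of j a b s hx hy => simp [Word.act]
  | id x => rfl
  | comp p q ih ih' => simp [Word.act, ih, ih']

theorem Word.act_comp {m m' m'' : SimplexCategoryᵒᵖ} (f : m ⟶ m') (g : m' ⟶ m'') {x y : Ob D}
    (p : Word D m x y) : p.act (f ≫ g) = (p.act f).act g := by
  induction p with
  | of j a b s hx hy => simp [Word.act]
  | id x => rfl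
  | comp p q ih ih' => simp [Word.act, ih, ih']

/-- The hom simplicial sets of the colimit. -/
def homObj (x y : Ob D) : SSet.{u} where
  obj m := Quot (WordRel m (x := x) (y := y))
  map f := ↾(Quot.map (Word.act f) (fun _ _ h => h.act f))
  map_id m := by
    ext p
    induction p using Quot.ind with | mk p => exact congrArg (Quot.mk _) p.act_id
  map_comp f g := by
    ext p
    induction p using Quot.ind with | mk p => exact congrArg (Quot.mk _) (p.act_comp f g)

/-- Composition of classes of words. -/
def compQuot {m : SimplexCategoryᵒᵖ} {x y z : Ob D} :
    Quot (WordRel m (x := x) (y := y)) → Quot (WordRel m (x := y) (y := z)) →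
      Quot (WordRel m (x := x) (y := z)) :=
  Quot.map₂ Word.comp (fun _ _ _ h => .congr (.refl _) h) (fun _ _ _ h => .congr h (.refl _))

instance : EnrichedCategory SSet.{u} (Ob D) where
  Hom x y := homObj x y
  id x := { app := fun m => ↾(fun _ => Quot.mk _ (Word.id x)), naturality := fun _ _ _ => rfl }
  comp x y z :=
    { app := fun m => ↾(fun p => compQuot p.1 p.2)
      naturality := fun m m' f => by
        ext ⟨p, q⟩
        induction p using Quot.ind with | mk p =>
        induction q using Quot.ind with | mk q => rfl }
  id_comp x y := by
    ext m p
    induction p using Quot.ind with | mk p => exact Quot.sound (.id_comp p)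
  comp_id x y := by
    ext m p
    induction p using Quot.ind with | mk p => exact Quot.sound (.comp_id p)
  assoc w x y z := by
    ext m ⟨p, q, r⟩
    induction p using Quot.ind with | mk p =>
    induction q using Quot.ind with | mk q =>
    induction r using Quot.ind with | mk r => exact Quot.sound (.assoc p q r)

/-- The canonical functor from a category of the diagram to the colimit. -/
def ι (j : J) : EnrichedFunctor SSet.{u} (D.obj j) (Ob D) where
  obj a := ob j a
  map a b :=
    { app := fun m => ↾(fun s => Quot.mk _ (Word.of j a b s rfl rfl))
      naturality := fun m m' f => by ext s; rfl }
  map_id a := by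
    ext m s
    exact Quot.sound (.of_id j a rfl)
  map_comp a b c := by
    ext m ⟨s, t⟩
    exact (Quot.sound (.of_comp j a b c s t rfl rfl rfl)).symm

theorem mk_of_heq {m : SimplexCategoryᵒᵖ} {x y x' y' : Ob D} (hx : x = x') (hy : y = y') (j : J)
    (a b : D.obj j) (s : Simp m a b) (h₁ : ob j a = x) (h₂ : ob j b = y) (h₁' : ob j a = x')
    (h₂' : ob j b = y') :
    (Quot.mk (WordRel m) (Word.of j a b s h₁ h₂) : (homObj x y).obj m) ≍
      (Quot.mk (WordRel m) (Word.of j a b s h₁' h₂') : (homObj x' y').obj m) := by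
  subst hx hy
  rfl

variable (D)

/-- The colimit cocone. -/
def cocone : Cocone D where
  pt := ⟨Ob D⟩
  ι :=
    { app := fun j => ι j
      naturality := fun j j' f => by
        refine functor_ext (fun a => ob_map f a) (fun a b m s => ?_)
        exact (mk_of_heq (ob_map f a) (ob_map f b) j' _ _
          ((EnrichedFunctor.map (D.map f) a b).app m s) rfl rfl (ob_map f a) (ob_map f b)).trans
          (heq_of_eq (Quot.sound (.of_map f a b s rfl rfl)).symm) }

variable {D} (c : Cocone D)

/-- The functor out of the colimit induced by a cocone, on objects. -/
def descObj : Ob D → c.pt :=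
  Quot.lift (fun p => EnrichedFunctor.obj (c.ι.app p.1) p.2) (by
    rintro _ _ ⟨f, a⟩
    exact (congrArg (fun F : EnrichedFunctor SSet.{u} _ _ => F.obj a) (c.w f)).symm)

/-- The functor out of the colimit induced by a cocone, on words. -/
def descWord {m : SimplexCategoryᵒᵖ} {x y : Ob D} :
    Word D m x y → Simp m (descObj c x) (descObj c y)
  | .of j a b s hx hy =>
    cast (by subst hx hy; rfl) ((EnrichedFunctor.map (c.ι.app j) a b).app m s)
  | .id x => sId m _
  | .comp p q => sComp (descWord p) (descWord q)

theorem descWord_of {m : SimplexCategoryᵒᵖ} {x y : Ob D} (j : J) (a b : D.obj j) (s : Simp m a b)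
    (hx : ob j a = x) (hy : ob j b = y) :
    descWord c (.of j a b s hx hy) ≍ (EnrichedFunctor.map (c.ι.app j) a b).app m s :=
  cast_heq _ _

theorem descWord_rel {m : SimplexCategoryᵒᵖ} {x y : Ob D} {p q : Word D m x y}
    (h : WordRel m p q) : descWord c p = descWord c q := by
  induction h with
  | refl p => rfl
  | symm _ ih => exact ih.symm
  | trans _ _ ih ih' => exact ih.trans ih'
  | congr _ _ ih ih' => simp only [descWord, ih, ih']
  | id_comp p => exact sId_sComp _
  | comp_id p => exact sComp_sId _
  | assoc p q r => exact sComp_assoc _ _ _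
  | of_id j a hx =>
    subst hx
    exact functor_sId (c.ι.app j) a
  | of_comp j a b c' s t hx hy hz =>
    subst hx hy hz
    exact (functor_sComp (c.ι.app j) s t).symm
  | of_map f a b s hx hy =>
    apply eq_of_heq
    refine (descWord_of c _ _ _ _ _ _).trans (HEq.trans ?_ (descWord_of c _ _ _ _ _ _).symm)
    exact functor_congr (c.w f).symm a b s

theorem descWord_act {m m' : SimplexCategoryᵒᵖ} (f : m ⟶ m') {x y : Ob D} (p : Word D m x y) :
    descWord c (p.act f) = (descObj c x ⟶[SSet.{u}] descObj c y).map f (descWord c p) := by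
  induction p with
  | of j a b s hx hy =>
    subst hx hy
    exact NatTrans.naturality_apply (EnrichedFunctor.map (c.ι.app j) a b) f s
  | id x => exact (map_sId f _).symm
  | comp p q ih ih' =>
    simp only [Word.act, descWord, ih, ih']
    exact (map_sComp f _ _).symm

/-- The functor out of the colimit induced by a cocone. -/
def desc : EnrichedFunctor SSet.{u} (Ob D) c.pt where
  obj := descObj c
  map x y :=
    { app := fun m => ↾(Quot.lift (descWord c) (fun _ _ h => descWord_rel c h))
      naturality := fun m m' f => by
        ext p
        induction p using Quot.ind with | mk p => exact descWord_act c f p }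
  map_id x := by
    ext m s
    rfl
  map_comp x y z := by
    ext m ⟨p, q⟩
    induction p using Quot.ind with | mk p =>
    induction q using Quot.ind with | mk q => rfl

variable (D)

/-- The cocone constructed above is a colimit cocone. -/
def isColimit : IsColimit (cocone D) where
  desc c := desc c
  fac c j := functor_ext (fun a => rfl) (fun a b m s => HEq.rfl)
  uniq c F hF := by
    have hobj : ∀ x : Ob D, EnrichedFunctor.obj F x = descObj c x := by
      intro x
      induction x using Quot.ind with | mk p =>
      exact congrArg (fun G : EnrichedFunctor SSet.{u} _ _ => G.obj p.2) (hF p.1)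
    refine functor_ext hobj (fun x y m p => ?_)
    induction p using Quot.ind with | mk p =>
    change _ ≍ descWord c p
    induction p with
    | of j a b s hx hy =>
      subst hx hy
      exact functor_congr (hF j) a b s
    | id x => exact (heq_of_eq (functor_sId F x)).trans (sId_heq (hobj x))
    | comp p q ih ih' =>
      exact (heq_of_eq (functor_sComp F (Quot.mk _ p) (Quot.mk _ q))).trans
        (sComp_heq (hobj _) (hobj _) (hobj _) ih ih')

end Colim

instance : HasColimitsOfSize.{0, u} SCat.{u} where
  has_colimits_of_shape _ _ :=
    { has_colimit := fun D => ⟨⟨⟨Colim.cocone D, Colim.isColimit D⟩⟩⟩ }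

/-- The realization `𝔆`: the left Kan extension of the simplicial thickening along the Yoneda
embedding, so that `𝔆 A` is the colimit of the thickenings over the simplices of `A`. -/
noncomputable def realization : SSet.{u} ⥤ SCat.{u} :=
  (uliftYoneda.{u} : SimplexCategory ⥤ SSet.{u}).leftKanExtension thickening.{u}

/-- The adjunction `𝔆 ⊣ N_hc`. -/
noncomputable def adj : realization.{u} ⊣ Nhc.{u} :=
  Presheaf.uliftYonedaAdjunction.{0}
    ((uliftYoneda.{u} : SimplexCategory ⥤ SSet.{u}).leftKanExtension thickening.{u})
    (uliftYoneda.{u}.leftKanExtensionUnit thickening.{u})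

end SCat

/-! ### Anti-involutive objects -/

section AntiInvolution

variable {C : Type*} [Category C] {D : Type*} [Category D]

/-- For a category with a covariant involution `o` (with `e : o (o X) ≅ X`), a map `τ : o X ⟶ X`
is an anti-involution if `τᵒᵖ ∘ τ` is the identity of `o X`, the domain `o (o X)` of `τᵒᵖ` being
identified with `X` by `e`. -/
def IsAntiInvolution (o : C ⥤ C) (e : o ⋙ o ≅ 𝟭 C) {X : C} (τ : o.obj X ⟶ X) : Prop :=
  τ ≫ e.inv.app X ≫ o.map τ = 𝟙 (o.obj X)

/-- Objects equipped with an anti-involution. -/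
structure AntiInvolutive (o : C ⥤ C) (e : o ⋙ o ≅ 𝟭 C) where
  /-- the underlying object -/
  obj : C
  /-- the anti-involution -/
  τ : o.obj obj ⟶ obj
  isAntiInvolution : IsAntiInvolution o e τ

namespace AntiInvolutive

variable {o : C ⥤ C} {e : o ⋙ o ≅ 𝟭 C}

/-- Morphisms are the maps `f` with `τ ∘ fᵒᵖ = f ∘ τ`. -/
@[ext]
structure Hom (X Y : AntiInvolutive o e) where
  /-- the underlying map -/
  hom : X.obj ⟶ Y.obj
  comm : o.map hom ≫ Y.τ = X.τ ≫ hom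

instance : Category (AntiInvolutive o e) where
  Hom X Y := Hom X Y
  id X := ⟨𝟙 X.obj, by simp⟩
  comp f g := ⟨f.hom ≫ g.hom, by rw [o.map_comp, Category.assoc, g.comm, ← Category.assoc, f.comm,
    Category.assoc]⟩
  id_comp f := Hom.ext (Category.id_comp f.hom)
  comp_id f := Hom.ext (Category.comp_id f.hom)
  assoc f g h := Hom.ext (Category.assoc f.hom g.hom h.hom)

end AntiInvolutive

variable {o : C ⥤ C} {e : o ⋙ o ≅ 𝟭 C} {o' : D ⥤ D} {e' : o' ⋙ o' ≅ 𝟭 D}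

/-- For a natural isomorphism `k : (H -)ᵒᵖ ≅ H (-ᵒᵖ)`, the condition `k⁻¹ = kᵒᵖ`: for every `X`,
the maps `(k_X)ᵒᵖ : H X = (H X)ᵒᵖᵒᵖ ⟶ (H Xᵒᵖ)ᵒᵖ` and
`k_{Xᵒᵖ} : (H Xᵒᵖ)ᵒᵖ ⟶ H Xᵒᵖᵒᵖ = H X` are inverse to each other. -/
def InverseEqOp (e : o ⋙ o ≅ 𝟭 C) (e' : o' ⋙ o' ≅ 𝟭 D) {H : C ⥤ D} (k : H ⋙ o' ≅ o ⋙ H) : Prop :=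
  ∀ X : C, (e'.inv.app (H.obj X) ≫ o'.map (k.hom.app X)) ≫
    (k.hom.app (o.obj X) ≫ H.map (e.hom.app X)) = 𝟙 (H.obj X)

/-- The map `H(τ) ∘ k_X : (H X)ᵒᵖ ⟶ H X` obtained from `τ : Xᵒᵖ ⟶ X`. -/
def transport {H : C ⥤ D} (k : H ⋙ o' ≅ o ⋙ H) {X : C} (τ : o.obj X ⟶ X) :
    o'.obj (H.obj X) ⟶ H.obj X :=
  k.hom.app X ≫ H.map τ

theorem IsAntiInvolution.transport {H : C ⥤ D} {k : H ⋙ o' ≅ o ⋙ H} (hk : InverseEqOp e e' k)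
    {X : C} {τ : o.obj X ⟶ X} (hτ : IsAntiInvolution o e τ) :
    IsAntiInvolution o' e' (_root_.transport k τ) := by
  unfold IsAntiInvolution _root_.transport at *
  have h := hk X
  have hn := k.hom.naturality τ
  dsimp at h hn hτ ⊢
  rw [← cancel_mono (k.hom.app X)]
  simp only [Functor.map_comp, Category.assoc, Category.id_comp]
  dsimp
  rw [hn]
  have h2 : e'.inv.app (H.obj X) ≫ o'.map (k.hom.app X) ≫ k.hom.app (o.obj X) =
      H.map (e.inv.app X) := by
    rw [← cancel_mono (H.map (e.hom.app X)), ← H.map_comp]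
    simpa using h
  have h3 := congrArg (fun t => k.hom.app X ≫ H.map t) hτ
  simp only [Functor.map_comp] at h3
  rw [← reassoc_of% h2] at h3
  simpa using h3

/-- The functor `(X, τ) ↦ (H X, H(τ) ∘ k_X)`, `f ↦ H f`. -/
def liftFunctor (H : C ⥤ D) (k : H ⋙ o' ≅ o ⋙ H) (hk : InverseEqOp e e' k) :
    AntiInvolutive o e ⥤ AntiInvolutive o' e' where
  obj X := ⟨H.obj X.obj, transport k X.τ, X.isAntiInvolution.transport hk⟩
  map {X Y} f := ⟨H.map f.hom, by
    have h := k.hom.naturality f.hom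
    have h' := congrArg H.map f.comm
    dsimp at h
    simp only [Functor.map_comp] at h'
    simp only [transport, Category.assoc, ← h']
    rw [reassoc_of% h]⟩
  map_id X := AntiInvolutive.Hom.ext (H.map_id X.obj)
  map_comp f g := AntiInvolutive.Hom.ext (H.map_comp f.hom g.hom)

end AntiInvolution

/-- Simplicial sets with anti-involution. -/
abbrev ISSet : Type (u + 1) := AntiInvolutive SSet.opFunctor.{u} SSet.opFunctorCompOpFunctorIso.{u}

/-- Simplicial categories with anti-involution. -/
abbrev ISCat : Type (u + 1) := AntiInvolutive SCat.opFunctor.{u} SCat.opOpIso.{u}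

/-- Coherence of a pair of natural isomorphisms `z : (N_hc -)ᵒᵖ ≅ N_hc (-ᵒᵖ)` and
`w : (𝔆 -)ᵒᵖ ≅ 𝔆 (-ᵒᵖ)`. -/
structure Coherent (z : SCat.Nhc.{u} ⋙ SSet.opFunctor.{u} ≅ SCat.opFunctor.{u} ⋙ SCat.Nhc.{u})
    (w : SCat.realization.{u} ⋙ SCat.opFunctor.{u} ≅
      SSet.opFunctor.{u} ⋙ SCat.realization.{u}) : Prop where
  /-- `z⁻¹ = zᵒᵖ` -/
  z_inv : InverseEqOp SCat.opOpIso SSet.opFunctorCompOpFunctorIso z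
  /-- `w⁻¹ = wᵒᵖ` -/
  w_inv : InverseEqOp SSet.opFunctorCompOpFunctorIso SCat.opOpIso w
  /-- `w_A⁻¹ = ε_{(𝔆 A)ᵒᵖ} ∘ 𝔆(z_{𝔆 A}) ∘ 𝔆((η_A)ᵒᵖ)` -/
  w_eq : ∀ A : SSet.{u}, w.inv.app A =
    SCat.realization.map (SSet.opFunctor.map (SCat.adj.unit.app A)) ≫
      SCat.realization.map (z.hom.app (SCat.realization.obj A)) ≫
        SCat.adj.counit.app (SCat.opFunctor.obj (SCat.realization.obj A))

/-- The lifted realization `(A, σ) ↦ (𝔆 A, 𝔆(σ) ∘ w_A)`. -/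
noncomputable def realizationTilde
    {z : SCat.Nhc.{u} ⋙ SSet.opFunctor.{u} ≅ SCat.opFunctor.{u} ⋙ SCat.Nhc.{u}}
    {w : SCat.realization.{u} ⋙ SCat.opFunctor.{u} ≅ SSet.opFunctor.{u} ⋙ SCat.realization.{u}}
    (h : Coherent z w) : ISSet.{u} ⥤ ISCat.{u} :=
  liftFunctor SCat.realization w h.w_inv

/-- The lifted homotopy coherent nerve `(X, τ) ↦ (N_hc X, N_hc(τ) ∘ z_X)`. -/
noncomputable def NhcTilde
    {z : SCat.Nhc.{u} ⋙ SSet.opFunctor.{u} ≅ SCat.opFunctor.{u} ⋙ SCat.Nhc.{u}}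
    {w : SCat.realization.{u} ⋙ SCat.opFunctor.{u} ≅ SSet.opFunctor.{u} ⋙ SCat.realization.{u}}
    (h : Coherent z w) : ISCat.{u} ⥤ ISSet.{u} :=
  liftFunctor SCat.Nhc z h.z_inv

/-!
Call a transformation `v : H (-ᵒᵖ) ⟶ (H -)ᵒᵖ` coherent if `(v_X)ᵒᵖ ∘ v_{Xᵒᵖ}` is the identity of
`H X`. A coherent `v` is invertible: the `v_{Xᵒᵖ}` are split monomorphisms and the `(v_X)ᵒᵖ` are
split epimorphisms. Coherence is moreover preserved by composition of functors, by passing from a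
cosimplicial object to its nerve, and by passing from `z` to its mate along an adjunction.
The formula prescribed for `w⁻¹` is the mate of `z`, so everything reduces to a coherent comparison
for the simplicial thickening. This one is the composite of the reversal of `{0 < ... < n}` with the
isomorphism between the thickening of the dual of a linear order and the opposite of its thickening,
which is the identity on paths. That `w⁻¹` is the mate of `z` also says exactly that the unit and
the counit of `𝔆 ⊣ N_hc` respect the induced anti-involutions.
-/

theorem mateEquiv_symm_app {C₁ C₂ D₁ D₂ : Type*} [Category* C₁] [Category* C₂] [Category* D₁]
    [Category* D₂] {G : C₁ ⥤ C₂} {H : D₁ ⥤ D₂} {L₁ : C₁ ⥤ D₁} {R₁ : D₁ ⥤ C₁} {L₂ : C₂ ⥤ D₂}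
    {R₂ : D₂ ⥤ C₂} (adj₁ : L₁ ⊣ R₁) (adj₂ : L₂ ⊣ R₂) (α : TwoSquare R₁ H G R₂) (X : C₁) :
    ((mateEquiv adj₁ adj₂).symm α).app X =
      L₂.map (G.map (adj₁.unit.app X)) ≫ L₂.map (α.app (L₁.obj X)) ≫
        adj₂.counit.app (H.obj (L₁.obj X)) := by
  simp [mateEquiv]

section Involution

variable {C : Type*} [Category* C] {D : Type*} [Category* D] {E : Type*} [Category* E]
  {o : C ⥤ C} {e : o ⋙ o ≅ 𝟭 C} {o' : D ⥤ D} {e' : o' ⋙ o' ≅ 𝟭 D}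
  {o'' : E ⥤ E} {e'' : o'' ⋙ o'' ≅ 𝟭 E}

theorem isEquivalence_of_involution (e : o ⋙ o ≅ 𝟭 C) : o.IsEquivalence :=
  (CategoryTheory.Equivalence.mk o o e.symm e).isEquivalence_functor

/-- For a transformation `v : H (-ᵒᵖ) ⟶ (H -)ᵒᵖ`, the condition that `v_{Xᵒᵖ}` followed by
`(v_X)ᵒᵖ` is the identity of `H X`. It is `InverseEqOp` for the inverse of `v`, phrased so that it
makes sense before `v` is known to be invertible. -/
def OpCoherent (e : o ⋙ o ≅ 𝟭 C) (e' : o' ⋙ o' ≅ 𝟭 D) {H : C ⥤ D} (v : o ⋙ H ⟶ H ⋙ o') : Prop :=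
  ∀ X : C, H.map (e.inv.app X) ≫ v.app (o.obj X) ≫ o'.map (v.app X) ≫ e'.hom.app (H.obj X) =
    𝟙 (H.obj X)

namespace OpCoherent

variable {H : C ⥤ D} {v : o ⋙ H ⟶ H ⋙ o'}

theorem app_comp_map_app (hv : OpCoherent e e' v) (X : C) :
    v.app (o.obj X) ≫ o'.map (v.app X) = H.map (e.hom.app X) ≫ e'.inv.app (H.obj X) := by
  have h := hv X
  rw [← cancel_epi (H.map (e.inv.app X)), ← cancel_mono (e'.hom.app (H.obj X))]
  simpa [← Functor.map_comp_assoc] using h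

/-- The maps `v_{Xᵒᵖ}` are split monomorphisms and the maps `(v_X)ᵒᵖ` are split epimorphisms, so
that `(v_{Xᵒᵖ})ᵒᵖ` is both. -/
theorem isIso (hv : OpCoherent e e' v) : IsIso v := by
  have : o'.IsEquivalence := isEquivalence_of_involution e'
  have isIso_comp (X : C) : IsIso (v.app (o.obj X) ≫ o'.map (v.app X)) := by
    rw [hv.app_comp_map_app]
    infer_instance
  have isIso_app_op (X : C) : IsIso (v.app (o.obj X)) := by
    have : Mono (v.app (o.obj X)) := mono_of_mono _ (o'.map (v.app X))
    have : IsSplitEpi (o'.map (v.app (o.obj X))) := by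
      have := isIso_comp (o.obj X)
      exact IsSplitEpi.mk' ⟨inv (v.app (o.obj (o.obj X)) ≫ o'.map (v.app (o.obj X))) ≫
        v.app (o.obj (o.obj X)), by simp⟩
    have := isIso_of_mono_of_isSplitEpi (o'.map (v.app (o.obj X)))
    exact isIso_of_reflects_iso _ o'
  refine (NatTrans.isIso_iff_isIso_app v).2 fun X => ?_
  have : IsIso (o'.map (v.app X)) := IsIso.of_isIso_comp_left (v.app (o.obj X)) _
  exact isIso_of_reflects_iso _ o'

/-- The isomorphism `(H -)ᵒᵖ ≅ H (-ᵒᵖ)` inverse to a coherent transformation. -/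
noncomputable def iso (hv : OpCoherent e e' v) : H ⋙ o' ≅ o ⋙ H :=
  have := hv.isIso
  (asIso v).symm

theorem inverseEqOp_iso (hv : OpCoherent e e' v) : InverseEqOp e e' hv.iso := by
  intro X
  let vApp (Y : C) : H.obj (o.obj Y) ≅ o'.obj (H.obj Y) := hv.iso.symm.app Y
  have h : H.mapIso (e.symm.app X) ≪≫ vApp (o.obj X) ≪≫ o'.mapIso (vApp X) ≪≫ e'.app (H.obj X) =
      Iso.refl _ := Iso.ext (hv X)
  have hinv := congrArg Iso.inv h
  simp only [Iso.trans_inv, Category.assoc] at hinv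
  exact (Category.assoc _ _ _).trans hinv

theorem comp {G : D ⥤ E} {l : o' ⋙ G ⟶ G ⋙ o''} (hv : OpCoherent e e' v)
    (hl : OpCoherent e' e'' l) :
    OpCoherent e e'' (H := H ⋙ G) (Functor.whiskerRight v G ≫ Functor.whiskerLeft H l) := by
  intro X
  have hl_nat := l.naturality (v.app X)
  have hvX := congrArg (fun t => G.map t) (hv.app_comp_map_app X)
  simp only [Functor.map_comp] at hvX
  dsimp at hl_nat ⊢
  simp only [Functor.map_comp, Category.assoc]
  rw [← reassoc_of% hl_nat, reassoc_of% hvX, ← hl (H.obj X), ← G.map_comp_assoc, ← H.map_comp]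
  simp

variable {F : C ⥤ D} {R : D ⥤ C} (adj : F ⊣ R) {z : R ⋙ o ≅ o' ⋙ R}

theorem mateEquiv_symm (hz : InverseEqOp e' e z) :
    OpCoherent e e' ((mateEquiv adj adj).symm z.hom) := by
  intro A
  set v : o ⋙ F ⟶ F ⋙ o' := (mateEquiv adj adj).symm z.hom
  have unit_v (B : C) : adj.unit.app (o.obj B) ≫ R.map (v.app B) =
      o.map (adj.unit.app B) ≫ z.hom.app (F.obj B) :=
    (unit_mateEquiv_symm adj adj z.hom B).symm
  have z_nat := z.hom.naturality (v.app A)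
  have e_nat := e.inv.naturality (adj.unit.app A)
  have unit_nat := adj.unit.naturality (e.inv.app A)
  have hzA := hz (F.obj A)
  dsimp at z_nat e_nat unit_nat
  simp only [Category.assoc] at hzA
  apply (adj.homEquiv _ _).injective
  refine (adj.homEquiv_unit ..).trans (Eq.trans ?_ (adj.homEquiv_id A).symm)
  calc
    _ = adj.unit.app A ≫ R.map (F.map (e.inv.app A)) ≫ R.map (v.app (o.obj A)) ≫
          R.map (o'.map (v.app A)) ≫ R.map (e'.hom.app (F.obj A)) := by
      simp only [Functor.map_comp]
      rfl
    _ = e.inv.app A ≫ o.map (adj.unit.app (o.obj A) ≫ R.map (v.app A)) ≫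
          z.hom.app (o'.obj (F.obj A)) ≫ R.map (e'.hom.app (F.obj A)) := by
      rw [← reassoc_of% unit_nat, reassoc_of% unit_v, ← reassoc_of% z_nat, Functor.map_comp,
        Category.assoc]
    _ = adj.unit.app A ≫ e.inv.app (R.obj (F.obj A)) ≫ o.map (z.hom.app (F.obj A)) ≫
          z.hom.app (o'.obj (F.obj A)) ≫ R.map (e'.hom.app (F.obj A)) := by
      rw [unit_v, Functor.map_comp, Category.assoc, reassoc_of% e_nat]
    _ = adj.unit.app A := by
      rw [hzA]
      exact Category.comp_id _

end OpCoherent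

section LiftAdjunction

variable {F : C ⥤ D} {R : D ⥤ C} (adj : F ⊣ R) {z : R ⋙ o ≅ o' ⋙ R} {w : F ⋙ o' ≅ o ⋙ F}

theorem map_unit_comp_transport (h : w.inv = (mateEquiv adj adj).symm z.hom) {A : C}
    (σ : o.obj A ⟶ A) :
    o.map (adj.unit.app A) ≫ transport z (transport w σ) = σ ≫ adj.unit.app A := by
  have hmate := unit_mateEquiv_symm adj adj z.hom A
  have unit_nat := adj.unit.naturality σ
  rw [← h] at hmate
  dsimp at hmate unit_nat
  unfold transport
  rw [reassoc_of% hmate, unit_nat, ← R.map_comp, Iso.inv_hom_id_app_assoc]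

theorem map_counit_comp (h : w.inv = (mateEquiv adj adj).symm z.hom) {X : D}
    (τ : o'.obj X ⟶ X) :
    o'.map (adj.counit.app X) ≫ τ = transport w (transport z τ) ≫ adj.counit.app X := by
  have hmate := mateEquiv_counit_symm adj adj z.hom X
  have counit_nat := adj.counit.naturality τ
  rw [← h] at hmate
  dsimp at hmate counit_nat
  unfold transport
  rw [Functor.map_comp, Category.assoc, Category.assoc, counit_nat, reassoc_of% hmate,
    Iso.hom_inv_id_app_assoc]

/-- The lift of an adjunction to objects with anti-involution. -/
def liftAdjunction (hz : InverseEqOp e' e z) (hw : InverseEqOp e e' w)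
    (h : w.inv = (mateEquiv adj adj).symm z.hom) :
    liftFunctor F w hw ⊣ liftFunctor R z hz where
  unit :=
    { app A := ⟨adj.unit.app A.obj, map_unit_comp_transport adj h A.τ⟩
      naturality _ _ f := AntiInvolutive.Hom.ext (adj.unit.naturality f.hom) }
  counit :=
    { app X := ⟨adj.counit.app X.obj, map_counit_comp adj h X.τ⟩
      naturality _ _ f := AntiInvolutive.Hom.ext (adj.counit.naturality f.hom) }
  left_triangle_components A := AntiInvolutive.Hom.ext (adj.left_triangle_components A.obj)
  right_triangle_components X := AntiInvolutive.Hom.ext (adj.right_triangle_components X.obj)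

theorem liftAdjunction_homEquiv_hom (hz : InverseEqOp e' e z) (hw : InverseEqOp e e' w)
    (h : w.inv = (mateEquiv adj adj).symm z.hom) {A : AntiInvolutive o e}
    {X : AntiInvolutive o' e'} (f : (liftFunctor F w hw).obj A ⟶ X) :
    ((liftAdjunction adj hz hw h).homEquiv A X f).hom = adj.homEquiv A.obj X.obj f.hom :=
  (congrArg AntiInvolutive.Hom.hom (Adjunction.homEquiv_unit ..)).trans
    (adj.homEquiv_unit ..).symm

end LiftAdjunction

end Involution

section RestrictedYoneda

universe w v u₁

variable {E : Type u₁} [Category.{v} E] {o : E ⥤ E} {e : o ⋙ o ≅ 𝟭 E}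
  {T : SimplexCategory ⥤ E} {v : SimplexCategory.rev ⋙ T ⟶ T ⋙ o}

/-- For a cosimplicial object `T` with a comparison `v : T (-ᵒᵖ) ⟶ (T -)ᵒᵖ`, the transformation
`(N -)ᵒᵖ ⟶ N (-ᵒᵖ)` for the nerve `N X = Hom(T, X)`, sending a simplex `s : T n ⟶ X` to
`sᵒᵖ ∘ v_n`. -/
def nerveOpTrans (v : SimplexCategory.rev ⋙ T ⟶ T ⋙ o) :
    Presheaf.restrictedULiftYoneda.{w} T ⋙ SSet.opFunctor.{max w v} ⟶
      o ⋙ Presheaf.restrictedULiftYoneda.{w} T where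
  app X :=
    { app n := ↾fun s => ⟨v.app n.unop ≫ o.map (ULift.down s)⟩
      naturality n n' f := by
        ext s
        have v_nat : T.map f.unop ≫ v.app n.unop =
            v.app n'.unop ≫ o.map (T.map (SimplexCategory.rev.map f.unop)) :=
          (congrArg (T.map · ≫ v.app n.unop) (SimplexCategory.rev_map_rev_map f.unop)).symm.trans
            (v.naturality (SimplexCategory.rev.map f.unop))
        refine congrArg ULift.up ?_
        change v.app n'.unop ≫ o.map (T.map (SimplexCategory.rev.map f.unop) ≫ ULift.down s) =
          T.map f.unop ≫ v.app n.unop ≫ o.map (ULift.down s)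
        rw [o.map_comp, reassoc_of% v_nat] }
  naturality _ _ _ := by
    ext n s
    exact congrArg ULift.up ((v.app n.unop ≫= o.map_comp _ _).trans (Category.assoc ..).symm)

theorem isIso_nerveOpTrans [o.Full] [o.Faithful] [IsIso v] : IsIso (nerveOpTrans.{w} v) := by
  refine (NatTrans.isIso_iff_isIso_app _).2 fun X => (NatTrans.isIso_iff_isIso_app _).2 fun n =>
    (isIso_iff_bijective _).2 ?_
  have map_bijective := (Functor.FullyFaithful.ofFullyFaithful o).homEquiv
    (X := T.obj (SimplexCategory.rev.obj n.unop)) (Y := X) |>.bijective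
  have comp_bijective := (asIso (v.app n.unop)).homFromEquiv (Z := o.obj X) |>.symm.bijective
  exact Equiv.ulift.symm.bijective.comp <|
    (comp_bijective.comp map_bijective).comp Equiv.ulift.bijective

/-- The isomorphism `(N -)ᵒᵖ ≅ N (-ᵒᵖ)` for the nerve `N X = Hom(T, X)` of a cosimplicial object
`T` with a coherent comparison `T (-ᵒᵖ) ⟶ (T -)ᵒᵖ`. -/
noncomputable def nerveOpIso (hv : OpCoherent SimplexCategory.revCompRevIso e v) :
    Presheaf.restrictedULiftYoneda.{w} T ⋙ SSet.opFunctor.{max w v} ≅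
      o ⋙ Presheaf.restrictedULiftYoneda.{w} T :=
  have := hv.isIso
  have := isEquivalence_of_involution e
  have := isIso_nerveOpTrans.{w} (v := v)
  asIso (nerveOpTrans.{w} v)

theorem OpCoherent.app_comp_map_app_comp_map (hv : OpCoherent SimplexCategory.revCompRevIso e v)
    {n : SimplexCategory} {X : E} (s : T.obj n ⟶ X) :
    (v.app n ≫ o.map (v.app n ≫ o.map s)) ≫ e.hom.app X = s := by
  have e_nat := e.hom.naturality s
  have hvn : v.app n ≫ o.map (v.app n) ≫ e.hom.app (T.obj n) = 𝟙 (T.obj n) :=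
    (Category.id_comp _).symm.trans ((T.map_id n).symm =≫ _ |>.trans (hv n))
  dsimp at e_nat
  rw [o.map_comp, Category.assoc, Category.assoc, e_nat, reassoc_of% hvn]
  exact Category.id_comp s

theorem inverseEqOp_nerveOpIso (hv : OpCoherent SimplexCategory.revCompRevIso e v) :
    InverseEqOp e SSet.opFunctorCompOpFunctorIso (nerveOpIso.{w} hv) := by
  intro X
  ext n s
  exact congrArg ULift.up (hv.app_comp_map_app_comp_map (ULift.down s))

end RestrictedYoneda

namespace SCat

section Thickening

variable {J : Type u} [LinearOrder J]

instance (i j : SimplicialThickening J) : Quiver.IsThin (i ⟶ j) := fun _ _ =>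
  ⟨fun ⟨f⟩ ⟨g⟩ => congrArg _ (Subsingleton.elim f g)⟩

theorem thickening_simp_ext {i j : SimplicialThickening J} {m : SimplexCategoryᵒᵖ}
    {s t : Simp m i j}
    (h : ∀ k, (Functor.obj (D := i ⟶ j) s k).I = (Functor.obj (D := i ⟶ j) t k).I) : s = t :=
  CategoryTheory.Functor.ext (D := i ⟶ j) (fun k => SimplicialThickening.Path.ext (h k))
    (fun _ _ _ => Subsingleton.elim _ _)

/-- Reading a path of the dual of a linear order backwards. -/
def pathOfDual (i j : SimplicialThickening Jᵒᵈ) :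
    (i ⟶ j) ⥤ (SimplicialThickening.mk (OrderDual.ofDual j.as) ⟶
      SimplicialThickening.mk (OrderDual.ofDual i.as)) where
  obj p := ⟨OrderDual.toDual ⁻¹' p.I, p.right, p.left, p.le_right, p.left_le⟩
  map g := ⟨⟨⟨g.1.1.1⟩⟩⟩

/-- The comparison of the thickening of the dual of a linear order with the opposite of its
thickening, which is the identity on paths. -/
def thickeningOfDual (J : Type u) [LinearOrder J] :
    EnrichedFunctor SSet.{u} (SimplicialThickening Jᵒᵈ) (SimplicialThickening J)ᵒᵖ where
  obj i := op (.mk (OrderDual.ofDual i.as))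
  map i j := nerveMap (pathOfDual i j)
  map_id _ := by
    ext m s
    exact thickening_simp_ext (J := J) fun _ => rfl
  map_comp _ _ _ := by
    ext m ⟨s, t⟩
    exact thickening_simp_ext (J := J) fun _ => Set.union_comm ..

/-- The simplicial thickening of linear orders. -/
def linOrdThickening : LinOrd.{u} ⥤ SCat.{u} where
  obj J := ⟨SimplicialThickening J⟩
  map f := SimplicialThickening.functor f.hom
  map_id _ := SimplicialThickening.functor_id _
  map_comp f g := SimplicialThickening.functor_comp f.hom g.hom

/-- The comparisons `thickeningOfDual`, as a transformation. -/
def linOrdThickeningOp :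
    LinOrd.dual.{u} ⋙ linOrdThickening.{u} ⟶ linOrdThickening ⋙ opFunctor where
  app J := thickeningOfDual J
  naturality _ _ _ := functor_ext (fun _ => rfl) (fun _ _ _ _ => HEq.rfl)

theorem opCoherent_linOrdThickeningOp :
    OpCoherent LinOrd.dualEquiv.counitIso opOpIso linOrdThickeningOp.{u} := fun J =>
  functor_ext (fun _ => rfl) fun _ _ _ _ => heq_of_eq <|
    thickening_simp_ext (J := J) fun _ => Set.image_id _

end Thickening

section Simplex

/-- The inclusion of the simplex category in linear orders, lifted to the universe `u`. -/
def simplexToLinOrd : SimplexCategory ⥤ LinOrd.{u} where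
  obj n := .of (ULift.{u} (Fin (n.len + 1)))
  map f := LinOrd.ofHom f.toOrderHom.uliftMap

/-- The order-reversing bijections of the linear orders `{0 < ... < n}`. -/
def simplexToLinOrdRev :
    SimplexCategory.rev ⋙ simplexToLinOrd.{u} ⟶ simplexToLinOrd ⋙ LinOrd.dual where
  app n := LinOrd.ofHom
    { toFun i := OrderDual.toDual ⟨i.down.rev⟩
      monotone' _ _ h := Fin.rev_le_rev.2 h }
  naturality _ _ _ := by
    ext i
    exact congrArg (fun k => OrderDual.toDual (ULift.up k)) (Fin.rev_rev _)

theorem opCoherent_simplexToLinOrdRev :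
    OpCoherent SimplexCategory.revCompRevIso LinOrd.dualEquiv.counitIso
      simplexToLinOrdRev.{u} := by
  intro n
  ext i
  exact congrArg ULift.up (Fin.rev_rev i.down)

/-- The comparison of the thickening of the reversed simplex with the opposite of the thickening,
using that `thickening` is `simplexToLinOrd ⋙ linOrdThickening` by definition. -/
def thickeningOp : SimplexCategory.rev ⋙ thickening.{u} ⟶ thickening ⋙ opFunctor :=
  Functor.whiskerRight simplexToLinOrdRev linOrdThickening ≫
    Functor.whiskerLeft simplexToLinOrd linOrdThickeningOp

theorem opCoherent_thickeningOp :
    OpCoherent SimplexCategory.revCompRevIso opOpIso thickeningOp.{u} :=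
  opCoherent_simplexToLinOrdRev.comp opCoherent_linOrdThickeningOp

end Simplex

end SCat

theorem mainTheorem9 :
    (∃ (z : SCat.Nhc.{u} ⋙ SSet.opFunctor.{u} ≅ SCat.opFunctor.{u} ⋙ SCat.Nhc.{u})
       (w : SCat.realization.{u} ⋙ SCat.opFunctor.{u} ≅
          SSet.opFunctor.{u} ⋙ SCat.realization.{u}), Coherent z w) ∧
    ∀ (z : SCat.Nhc.{u} ⋙ SSet.opFunctor.{u} ≅ SCat.opFunctor.{u} ⋙ SCat.Nhc.{u})
      (w : SCat.realization.{u} ⋙ SCat.opFunctor.{u} ≅ SSet.opFunctor.{u} ⋙ SCat.realization.{u})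
      (h : Coherent z w),
      (∀ (X : SCat.{u}) (τ : SCat.opFunctor.obj X ⟶ X),
        IsAntiInvolution SCat.opFunctor SCat.opOpIso τ →
          IsAntiInvolution SSet.opFunctor SSet.opFunctorCompOpFunctorIso (transport z τ)) ∧
      (∀ (A : SSet.{u}) (σ : SSet.opFunctor.obj A ⟶ A),
        IsAntiInvolution SSet.opFunctor SSet.opFunctorCompOpFunctorIso σ →
          IsAntiInvolution SCat.opFunctor SCat.opOpIso (transport w σ)) ∧
      ∃ adj' : realizationTilde h ⊣ NhcTilde h,
        ∀ (A : ISSet.{u}) (X : ISCat.{u}) (f : (realizationTilde h).obj A ⟶ X),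
          (adj'.homEquiv A X f).hom = SCat.adj.homEquiv A.obj X.obj f.hom := by
  have hz := inverseEqOp_nerveOpIso.{0} SCat.opCoherent_thickeningOp.{u}
  have hw := OpCoherent.mateEquiv_symm SCat.adj hz
  refine ⟨⟨nerveOpIso SCat.opCoherent_thickeningOp, hw.iso, hz, hw.inverseEqOp_iso,
    mateEquiv_symm_app SCat.adj SCat.adj _⟩, fun z w h => ?_⟩
  have w_inv_eq_mate : w.inv = (mateEquiv SCat.adj SCat.adj).symm z.hom :=
    NatTrans.ext <| funext fun A =>
      (h.w_eq A).trans (mateEquiv_symm_app SCat.adj SCat.adj z.hom A).symm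
  exact ⟨fun _ _ hτ => hτ.transport h.z_inv, fun _ _ hσ => hσ.transport h.w_inv,
    liftAdjunction SCat.adj h.z_inv h.w_inv w_inv_eq_mate,
    fun _ _ f => liftAdjunction_homEquiv_hom SCat.adj h.z_inv h.w_inv w_inv_eq_mate f⟩
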